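/- **Setting.** Fix a function-free vocabulary $\Sigma$ and a (possibly infinite) domain $D$. Domain atoms are $P(\bar d)$ with $P\in\Sigma$, $\bar d\in D^n$, together with the logical atoms $\top,\bot,d=d'$, which have their fixed meaning in every structure; domain literals are domain atoms and their negations. A (four-valued) structure $I$ is identified with a set of domain literals: an atom $a$ is true, false, inconsistent or unknown in $I$ if $I$ contains only $a$, only $\neg a$, both, or neither. $I'$ expands $I$ if $I\subseteq I'$. For a set $S$ of literals, $I|_S=I\cap S$. Formulas (with quantifiers $\exists x\in D'$, $\forall x\in D'$, $D'\subseteq D$) get the standard four-valued truth value. A definition is a set of rules $\forall\bar x\in\bar D:\ P(\bar x)\leftarrow\varphi$, each domain atom being defined by at most one rule; $P(\bar d)$ and $\neg P(\bar d)$ are defined by it if some rule has head predicate $P$ and $\bar d\in\bar D$, and other literals are open. For a structure $O$ of the open atoms, the well-founded model of $\Delta$ in $O$ is the least fixpoint of the operator that maps $X$ to the literals of $O$, the defined atoms whose body is true in $X$, and the negations of all atoms in sets $U$ of defined atoms such that the body of each atom of $U$ is false in $X\cup\{\neg a: a\in U\}$. $\Delta$ is total if its well-founded model is two-valued for every two-valued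 $O$. A two-valued structure $M$ satisfies $\Delta$ if it equals the well-founded model of $\Delta$ in the restriction of $M$ to the open atoms. $M$ is a model of the theory $\{p,\Delta\}$, $p$ an atomic sentence, if $M$ is two-valued, satisfies $\Delta$ and makes $p$ true. Definitions $\Delta,\Delta'$ are strongly $\sigma$-equivalent if each model of $\Delta$ (a structure over the symbols occurring in $\Delta$), restricted to $\sigma$, has a unique expansion to a model of $\Delta'$ (over the symbols of $\Delta'$), and vice versa. A direct justification of a literal $P(\bar d)$ (resp. $\neg P(\bar d)$) defined by $\Delta$ is a consistent non-empty set $S$ of domain literals such that the body of the rule for $P(\bar d)$, with $\bar x$ replaced by $\bar d$, is true (resp. false) in $S$. A justification over $\Delta$ is a directed graph $J$ on the domain literals such that the set $J(l)$ of children of each literal $l$ is empty or a direct justification of $l$. $J_L$ denotes the subgraph reachable from the set $L$ of literals (including $L$ itself), and $J_l=J_{\{l\}}$. $J$ justifies a set $L$ of literals defined by $\Delta$ if (i) $J(l)\neq\emptyset$ for every literal $l$ in $J_L$ defined by $\Delta$; (ii) for each $l\in L$ every infinite path in $J_l$ consists of negative literals only; (iii) the set of literals in $J_L$ is consistent. A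 graph $J$ is consistent with $I$ if $I$ is consistent and no literal $l$ with $J(l)\ne\emptyset$ is false in $I$. Let $\mathcal T=\{p_{\mathcal T},\Delta\}$ with $p_{\mathcal T}$ an atomic sentence and $\Delta$ a total definition, and let $I_{in}$ be an input structure. $\langle\Delta_g,\Delta_d,J,I\rangle$ is an acceptable state if, with $\Delta_{gd}=\Delta_g\cup\Delta_d$: (i) $\Delta_{gd},\Delta_g,\Delta_d$ are total and $\Delta_{gd}$ is strongly equivalent with $\Delta$ with respect to the set of predicate symbols occurring in $\Delta$; (ii) no domain atom is defined in both $\Delta_g$ and $\Delta_d$; (iii) $J$ is a justification over $\Delta_{gd}$; (iv) $I$ expands $I_{in}$; (v) the set $L$ of literals true in $I$ and defined in $\Delta_d$ is justified by $J$ (over $\Delta_{gd}$); (vi) $J_L$ is consistent with $I$. **Corollary.** Let $\langle\Delta_g,\Delta_d,J,I\rangle$ be an acceptable state of $\mathcal T=\{p_{\mathcal T},\Delta\}$ with input structure $I_{in}$ such that $p_{\mathcal T}$ is true in $I$ and $J$ justifies $\{p_{\mathcal T}\}$ over $\Delta_{gd}$. Then there exists a model $M$ of $\mathcal T$ (a two-valued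 structure over $\Sigma$) that expands $I|_S=I\cap S$, where $S$ is the set of literals in $J_{p_{\mathcal T}}$ that are defined by $\Delta_{gd}$. -/

import Mathlib

/-!
Syntax and four-valued semantics of function-free FO(ID) over a fixed, possibly infinite, domain:
formulas, rules, definitions, well-founded models, justifications and acceptable states.
-/

namespace FOID

universe u v

/-- A function-free vocabulary: predicate symbols with arities (0-ary ones are propositional
symbols).  The logical symbols `⊤`, `⊥` and `=` are not listed here; they are always present. -/
structure Vocabulary where
  Pred : Type u
  arity : Pred → ℕ

/-- Domain atoms: `⊤`, `⊥`, `d = d'` and `P(d₁, …, dₙ)`. -/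
inductive DomAtom (V : Vocabulary.{u}) (D : Type v) : Type (max u v)
  | verum : DomAtom V D
  | falsum : DomAtom V D
  | eq (d d' : D) : DomAtom V D
  | pred (P : V.Pred) (d : Fin (V.arity P) → D) : DomAtom V D

/-- Domain literals: domain atoms and their negations. -/
inductive DomLit (V : Vocabulary.{u}) (D : Type v) : Type (max u v)
  | pos (a : DomAtom V D) : DomLit V D
  | neg (a : DomAtom V D) : DomLit V D

variable {V : Vocabulary.{u}} {D : Type v}

/-- The atom of a literal. -/
def DomLit.atom : DomLit V D → DomAtom V D
  | .pos a => a
  | .neg a => a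

/-- The negative literals. -/
def DomLit.IsNegative : DomLit V D → Prop
  | .pos _ => False
  | .neg _ => True

/-- The literals whose truth is fixed by the logical symbols: `⊤`, `¬⊥`, `d = d`, and `¬ d = d'`
for distinct `d`, `d'`. -/
def logicalLits (V : Vocabulary.{u}) (D : Type v) : Set (DomLit V D) :=
  {l | l = .pos .verum ∨ l = .neg .falsum ∨ (∃ d, l = .pos (.eq d d)) ∨
    ∃ d d', d ≠ d' ∧ l = .neg (.eq d d')}

/-- The four truth values, as pairs (evidence for, evidence against):
t = (1,0), f = (0,1), u = (0,0), i = (1,1).  The order of this complete lattice is the truth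
order: `⊤` is t, `⊥` is f, while u and i are incomparable and lie in between. -/
abbrev TruthVal : Type := Prop × Propᵒᵈ

/-- The value is t or i. -/
def TruthVal.pro (w : TruthVal) : Prop := w.1

/-- The value is f or i. -/
def TruthVal.con (w : TruthVal) : Prop := OrderDual.ofDual w.2

/-- The truth value with the given evidence for and against. -/
def TruthVal.mk (p c : Prop) : TruthVal := (p, OrderDual.toDual c)

/-- The inverse of a truth value: swaps t and f, and fixes u and i. -/
def TruthVal.inv (w : TruthVal) : TruthVal := TruthVal.mk w.con w.pro

/-- A (four-valued) structure with domain `D`, given as a set of domain literals. -/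
abbrev Struct (V : Vocabulary.{u}) (D : Type v) : Type (max u v) := Set (DomLit V D)

/-- The truth value of a domain atom in a structure.  The logical literals hold in every
structure, whether or not they are listed in the set. -/
def val (S : Struct V D) (a : DomAtom V D) : TruthVal :=
  TruthVal.mk (.pos a ∈ S ∪ logicalLits V D) (.neg a ∈ S ∪ logicalLits V D)

/-- The truth value of a domain literal in a structure. -/
def litVal (S : Struct V D) : DomLit V D → TruthVal
  | .pos a => val S a
  | .neg a => (val S a).inv

/-- The literal has the value t. -/
def TrueIn (S : Struct V D) (l : DomLit V D) : Prop := litVal S l = ⊤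

/-- The literal has the value f. -/
def FalseIn (S : Struct V D) (l : DomLit V D) : Prop := litVal S l = ⊥

/-- No domain atom has the value i. -/
def Consistent (S : Struct V D) : Prop := ∀ a, ¬ ((val S a).pro ∧ (val S a).con)

/-- `S` is a two-valued structure of the set `A` of domain atoms: the atoms in `A` are two-valued
and the other ones are unknown. -/
def IsTwoValuedOn (A : Set (DomAtom V D)) (S : Struct V D) : Prop :=
  Consistent S ∧ (∀ a ∈ A, Xor (.pos a ∈ S) (.neg a ∈ S)) ∧
    ∀ a, a ∉ A → .pos a ∉ S ∧ .neg a ∉ S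

/-- The domain atoms over a set `σ` of predicate symbols (including the logical ones). -/
def atomsOver (D : Type v) (σ : Set V.Pred) : Set (DomAtom V D) :=
  {a | ∀ P d, a = .pred P d → P ∈ σ}

/-- The restriction of a structure to a set of domain atoms. -/
def restrictAtoms (S : Struct V D) (A : Set (DomAtom V D)) : Struct V D := {l ∈ S | l.atom ∈ A}

/-- Terms with `n` free variables: variables and domain elements. -/
abbrev Term (D : Type v) (n : ℕ) : Type v := Fin n ⊕ D

/-- The domain element denoted by a term. -/
def Term.eval {n : ℕ} (x : Fin n → D) : Term D n → D
  | .inl i => x i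
  | .inr d => d

/-- Function-free first-order formulas with free variables `0, …, n - 1` and with quantification
over explicitly given subsets of the domain; a quantifier binds the new variable `0`. -/
inductive Formula (V : Vocabulary.{u}) (D : Type v) : ℕ → Type (max u v)
  | verum {n : ℕ} : Formula V D n
  | falsum {n : ℕ} : Formula V D n
  | eq {n : ℕ} (s t : Term D n) : Formula V D n
  | pred {n : ℕ} (P : V.Pred) (t : Fin (V.arity P) → Term D n) : Formula V D n
  | not {n : ℕ} (φ : Formula V D n) : Formula V D n
  | and {n : ℕ} (φ ψ : Formula V D n) : Formula V D n
  | or {n : ℕ} (φ ψ : Formula V D n) : Formula V D n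
  | ex {n : ℕ} (D' : Set D) (φ : Formula V D (n + 1)) : Formula V D n
  | all {n : ℕ} (D' : Set D) (φ : Formula V D (n + 1)) : Formula V D n

/-- The four-valued truth assignment: the value in `S` of the formula in which the free variables
are replaced by the domain elements `x`. -/
noncomputable def Formula.eval (S : Struct V D) : {n : ℕ} → Formula V D n → (Fin n → D) → TruthVal
  | _, .verum, _ => val S .verum
  | _, .falsum, _ => val S .falsum
  | _, .eq s t, x => val S (.eq (s.eval x) (t.eval x))
  | _, .pred P t, x => val S (.pred P fun i => (t i).eval x)
  | _, .not φ, x => (φ.eval S x).inv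
  | _, .and φ ψ, x => φ.eval S x ⊓ ψ.eval S x
  | _, .or φ ψ, x => φ.eval S x ⊔ ψ.eval S x
  | _, .ex D' φ, x => ⨆ d ∈ D', φ.eval S (Fin.cons d x)
  | _, .all D' φ, x => ⨅ d ∈ D', φ.eval S (Fin.cons d x)

/-- The predicate symbols that occur in a formula. -/
def Formula.voc : {n : ℕ} → Formula V D n → Set V.Pred
  | _, .verum => ∅
  | _, .falsum => ∅
  | _, .eq _ _ => ∅
  | _, .pred P _ => {P}
  | _, .not φ => φ.voc
  | _, .and φ ψ => φ.voc ∪ ψ.voc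
  | _, .or φ ψ => φ.voc ∪ ψ.voc
  | _, .ex _ φ => φ.voc
  | _, .all _ φ => φ.voc

/-- A rule `∀ x ∈ dom : P(x) ← body`. -/
structure Rule (V : Vocabulary.{u}) (D : Type v) where
  P : V.Pred
  dom : Set (Fin (V.arity P) → D)
  body : Formula V D (V.arity P)

/-- A set of rules. -/
abbrev Definition (V : Vocabulary.{u}) (D : Type v) : Type (max u v) := Set (Rule V D)

/-- Every domain atom is defined by at most one rule. -/
def RulesDisjoint (Δ : Definition V D) : Prop :=
  ∀ r ∈ Δ, ∀ r' ∈ Δ, ∀ x ∈ r.dom, ∀ x' ∈ r'.dom,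
    DomAtom.pred (V := V) r.P x = .pred r'.P x' → r = r'

/-- The domain atoms defined by `Δ`. -/
def definedAtoms (Δ : Definition V D) : Set (DomAtom V D) :=
  {a | ∃ r ∈ Δ, ∃ x ∈ r.dom, a = .pred r.P x}

/-- The domain atoms that are open in `Δ`. -/
def openAtoms (Δ : Definition V D) : Set (DomAtom V D) := (definedAtoms Δ)ᶜ

/-- The literal is defined by `Δ`, that is, its atom is. -/
def IsDefined (Δ : Definition V D) (l : DomLit V D) : Prop := l.atom ∈ definedAtoms Δ

/-- The predicate symbols that occur in a definition. -/
def voc (Δ : Definition V D) : Set V.Pred := {Q | ∃ r ∈ Δ, Q = r.P ∨ Q ∈ r.body.voc}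

/-- The set `U` of defined domain atoms is unfounded with respect to `X`: once all atoms of `U`
are made false, the body for each of them is false. -/
def IsUnfounded (Δ : Definition V D) (X : Struct V D) (U : Set (DomAtom V D)) : Prop :=
  U ⊆ definedAtoms Δ ∧
    ∀ r ∈ Δ, ∀ x ∈ r.dom, DomAtom.pred r.P x ∈ U →
      (r.body.eval (X ∪ DomLit.neg '' U) x).con

/-- The well-founded operator in the open structure `O`: it yields the open literals of `O`, the
defined atoms with a body true in `X`, and the negations of the atoms of unfounded sets. -/
def wfStep (Δ : Definition V D) (O X : Struct V D) : Struct V D :=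
  restrictAtoms O (openAtoms Δ) ∪
    {l | ∃ r ∈ Δ, ∃ x ∈ r.dom, l = .pos (.pred r.P x) ∧ (r.body.eval X x).pro} ∪
    {l | ∃ U, IsUnfounded Δ X U ∧ ∃ a ∈ U, l = .neg a}

/-- The precision order on truth values. -/
def TruthVal.LeP (w w' : TruthVal) : Prop := (w.pro → w'.pro) ∧ (w.con → w'.con)

theorem TruthVal.pro_iSup {ι : Sort*} (f : ι → TruthVal) : (⨆ i, f i).pro ↔ ∃ i, (f i).pro := by
  unfold TruthVal.pro
  rw [Prod.fst_iSup, iSup_Prop_eq]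

theorem TruthVal.pro_iInf {ι : Sort*} (f : ι → TruthVal) : (⨅ i, f i).pro ↔ ∀ i, (f i).pro := by
  unfold TruthVal.pro
  rw [Prod.fst_iInf, iInf_Prop_eq]

theorem TruthVal.con_iSup {ι : Sort*} (f : ι → TruthVal) : (⨆ i, f i).con ↔ ∀ i, (f i).con := by
  unfold TruthVal.con
  rw [Prod.snd_iSup, ofDual_iSup, iInf_Prop_eq]

theorem TruthVal.con_iInf {ι : Sort*} (f : ι → TruthVal) : (⨅ i, f i).con ↔ ∃ i, (f i).con := by
  unfold TruthVal.con
  rw [Prod.snd_iInf, ofDual_iInf, iSup_Prop_eq]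

theorem val_mono {S S' : Struct V D} (h : S ⊆ S') (a : DomAtom V D) :
    (val S a).LeP (val S' a) :=
  ⟨fun k => Set.union_subset_union_left _ h k, fun k => Set.union_subset_union_left _ h k⟩

/-- The truth assignment is monotone in the precision order. -/
theorem Formula.eval_mono {S S' : Struct V D} (h : S ⊆ S') :
    ∀ {n : ℕ} (φ : Formula V D n) (x : Fin n → D), (φ.eval S x).LeP (φ.eval S' x)
  | _, .verum, _ => val_mono h _
  | _, .falsum, _ => val_mono h _
  | _, .eq _ _, _ => val_mono h _
  | _, .pred _ _, _ => val_mono h _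
  | _, .not φ, x => ⟨(φ.eval_mono h x).2, (φ.eval_mono h x).1⟩
  | _, .and φ ψ, x =>
    ⟨And.imp (φ.eval_mono h x).1 (ψ.eval_mono h x).1,
      Or.imp (φ.eval_mono h x).2 (ψ.eval_mono h x).2⟩
  | _, .or φ ψ, x =>
    ⟨Or.imp (φ.eval_mono h x).1 (ψ.eval_mono h x).1,
      And.imp (φ.eval_mono h x).2 (ψ.eval_mono h x).2⟩
  | _, .ex D' φ, x => by
    simp only [TruthVal.LeP, Formula.eval, TruthVal.pro_iSup, TruthVal.con_iSup]
    exact ⟨fun ⟨d, hd, k⟩ => ⟨d, hd, (φ.eval_mono h _).1 k⟩,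
      fun k d hd => (φ.eval_mono h _).2 (k d hd)⟩
  | _, .all D' φ, x => by
    simp only [TruthVal.LeP, Formula.eval, TruthVal.pro_iInf, TruthVal.con_iInf]
    exact ⟨fun k d hd => (φ.eval_mono h _).1 (k d hd),
      fun ⟨d, hd, k⟩ => ⟨d, hd, (φ.eval_mono h _).2 k⟩⟩

theorem wfStep_mono (Δ : Definition V D) (O : Struct V D) : Monotone (wfStep Δ O) := by
  intro X Y h
  refine Set.union_subset_union (Set.union_subset_union_right _ ?_) ?_
  · rintro l ⟨r, hr, x, hx, rfl, k⟩
    exact ⟨r, hr, x, hx, rfl, (Formula.eval_mono h _ _).1 k⟩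
  · rintro l ⟨U, ⟨hU, k⟩, a, ha, rfl⟩
    exact ⟨U, ⟨hU, fun r hr x hx m =>
      (Formula.eval_mono (Set.union_subset_union_left _ h) _ _).2 (k r hr x hx m)⟩, a, ha, rfl⟩

/-- The well-founded model of `Δ` in the open structure `O`: the least fixpoint, in the precision
order, of the well-founded operator. -/
def wfModel (Δ : Definition V D) (O : Struct V D) : Struct V D :=
  OrderHom.lfp ⟨wfStep Δ O, wfStep_mono Δ O⟩

/-- `Δ` is total: its well-founded model in every two-valued structure of its open atoms is
two-valued. -/
def Total (Δ : Definition V D) : Prop :=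
  ∀ O, IsTwoValuedOn (openAtoms Δ) O → IsTwoValuedOn Set.univ (wfModel Δ O)

/-- `M` is a two-valued structure of the vocabulary `σ` that satisfies `Δ`. -/
def IsModelOver (σ : Set V.Pred) (M : Struct V D) (Δ : Definition V D) : Prop :=
  IsTwoValuedOn (atomsOver D σ) M ∧ M = wfModel Δ (restrictAtoms M (openAtoms Δ))

/-- `M` is a model of the theory `{p, Δ}`: a two-valued structure of the whole vocabulary that
satisfies the atomic sentence `p` and the definition `Δ`. -/
def IsModelOfTheory (M : Struct V D) (p : DomAtom V D) (Δ : Definition V D) : Prop :=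
  IsModelOver Set.univ M Δ ∧ TrueIn M (.pos p)

/-- `Δ` and `Δ'`, as theories over their own vocabularies, are strongly `σ`-equivalent: the
restriction to `σ` of each model of one of them has a unique expansion to a model of the other. -/
def StronglyEquivalent (σ : Set V.Pred) (Δ Δ' : Definition V D) : Prop :=
  (∀ M, IsModelOver (voc Δ) M Δ →
    ∃! M', IsModelOver (voc Δ') M' Δ' ∧ restrictAtoms M (atomsOver D σ) ⊆ M') ∧
  ∀ M', IsModelOver (voc Δ') M' Δ' →
    ∃! M, IsModelOver (voc Δ) M Δ ∧ restrictAtoms M' (atomsOver D σ) ⊆ M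

/-- `S` is a direct justification of the defined literal `l`. -/
def IsDirectJustification (Δ : Definition V D) (l : DomLit V D) (S : Set (DomLit V D)) : Prop :=
  S.Nonempty ∧ Consistent S ∧ ∃ r ∈ Δ, ∃ x ∈ r.dom,
    (l = .pos (.pred r.P x) ∧ r.body.eval S x = ⊤) ∨
    (l = .neg (.pred r.P x) ∧ r.body.eval S x = ⊥)

/-- A directed graph on the domain literals, as the map that sends a literal to the set of its
children. -/
abbrev LitGraph (V : Vocabulary.{u}) (D : Type v) : Type (max u v) :=
  DomLit V D → Set (DomLit V D)

/-- `J` is a justification over `Δ`. -/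
def IsJustification (Δ : Definition V D) (J : LitGraph V D) : Prop :=
  ∀ l, J l = ∅ ∨ IsDirectJustification Δ l (J l)

/-- The literals reachable in `J` from a literal of `L`, that is, the literals in `J_L`. -/
def nodesFrom (J : LitGraph V D) (L : Set (DomLit V D)) : Set (DomLit V D) :=
  {l | ∃ l₀ ∈ L, Relation.ReflTransGen (fun k k' => k' ∈ J k) l₀ l}

/-- The subgraph `J_L` of what is reachable in `J` from a literal of `L`. -/
def subgraphFrom (J : LitGraph V D) (L : Set (DomLit V D)) : LitGraph V D :=
  fun l => {l' | l ∈ nodesFrom J L ∧ l' ∈ J l}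

/-- `J` is total for `L`: it is defined in each literal that is reachable from `L` and defined
by `Δ`. -/
def TotalFor (Δ : Definition V D) (J : LitGraph V D) (L : Set (DomLit V D)) : Prop :=
  ∀ l ∈ nodesFrom J L, IsDefined Δ l → (J l).Nonempty

/-- `l` is well-founded in `J`: every infinite path in `J_l` consists of negative literals. -/
def WellFoundedIn (J : LitGraph V D) (l : DomLit V D) : Prop :=
  ∀ f : ℕ → DomLit V D, (∀ i, f (i + 1) ∈ subgraphFrom J {l} (f i)) → ∀ i, (f i).IsNegative

/-- `J` is consistent with the structure `I`. -/
def ConsistentWith (J : LitGraph V D) (I : Struct V D) : Prop :=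
  Consistent I ∧ ∀ l, (J l).Nonempty → ¬ FalseIn I l

/-- The justification `J` over `Δ` justifies the set `L` of literals defined by `Δ`. -/
structure Justifies (Δ : Definition V D) (J : LitGraph V D) (L : Set (DomLit V D)) : Prop where
  justification : IsJustification Δ J
  isDefined : ∀ l ∈ L, IsDefined Δ l
  total : TotalFor Δ (subgraphFrom J L) L
  wellFounded : ∀ l ∈ L, WellFoundedIn J l
  consistent : Consistent (nodesFrom J L)

/-- The literals that are true in `I` and defined by `Δ`. -/
def trueDefined (Δ : Definition V D) (I : Struct V D) : Set (DomLit V D) :=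
  {l | TrueIn I l ∧ IsDefined Δ l}

/-- `⟨Δg, Δd, J, I⟩` is an acceptable state of a theory with definition `Δ` and of the input
structure `Iin`. -/
structure IsAcceptable (Δ : Definition V D) (Iin : Struct V D) (Δg Δd : Definition V D)
    (J : LitGraph V D) (I : Struct V D) : Prop where
  total_union : Total (Δg ∪ Δd)
  total_grounded : Total Δg
  total_delayed : Total Δd
  equivalent : StronglyEquivalent (voc Δ) (Δg ∪ Δd) Δ
  disjoint : Disjoint (definedAtoms Δg) (definedAtoms Δd)
  justification : IsJustification (Δg ∪ Δd) J
  expansion : Iin ⊆ I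
  justifies : Justifies (Δg ∪ Δd) J (trueDefined Δd I)
  consistent : ConsistentWith (subgraphFrom J (trueDefined Δd I)) I

end FOID

/-!
The positive literal `p` is justified by `J` over `Δg ∪ Δd`.  An infinite path of `J` that starts in
`p` would have to consist of negative literals, so there is none, and the subgraph `J_p` is
well-founded: it is a proof of `p` by induction.  Its literals form a consistent set, hence there is
a two-valued structure `O` of the open atoms of `Δg ∪ Δd` in which the open literals of `J_p` are
true (`exists_isTwoValuedOn_extending`).  Well-founded induction along `J_p` then shows that all
literals of `J_p` belong to the well-founded model `M₀` of `Δg ∪ Δd` in `O`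
(`nodesFrom_subset_of_isFixedPt`): a direct justification of a positive literal makes a rule fire,
and one of a negative literal `¬ a` shows that `{a}` is unfounded.  By totality `M₀` is two-valued.

It remains to move from `Δg ∪ Δd` to `Δ`.  Strong equivalence speaks of structures over the symbols
of the two definitions, so `M₀` is first restricted to the symbols of `Δg ∪ Δd`, and the
corresponding model of `Δ` is afterwards extended to the whole vocabulary, with the values of `M₀`
for the symbols that do not occur in `Δ`.  Both steps rest on `restrictAtoms_wfModel`:
well-founded models commute with the restriction to any set of symbols that contains those of the
definition.
-/

namespace FOID

universe u v

variable {V : Vocabulary.{u}} {D : Type v}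

/-! ### Restrictions and two-valued structures -/

theorem mem_restrictAtoms {S : Struct V D} {A : Set (DomAtom V D)} {l : DomLit V D} :
    l ∈ restrictAtoms S A ↔ l ∈ S ∧ l.atom ∈ A := Iff.rfl

theorem restrictAtoms_subset (S : Struct V D) (A : Set (DomAtom V D)) : restrictAtoms S A ⊆ S :=
  fun _ h => h.1

theorem restrictAtoms_comm (S : Struct V D) (A B : Set (DomAtom V D)) :
    restrictAtoms (restrictAtoms S A) B = restrictAtoms (restrictAtoms S B) A := by
  ext l
  simp only [mem_restrictAtoms, and_right_comm]

theorem Consistent.mono {S S' : Struct V D} (h : S ⊆ S') (hS' : Consistent S') : Consistent S :=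
  fun a k => hS' a ⟨(val_mono h a).1 k.1, (val_mono h a).2 k.2⟩

/-- A set of literals is inconsistent only through a pair of opposite literals or through a literal
that contradicts the meaning of a logical atom. -/
theorem consistent_iff {S : Struct V D} :
    Consistent S ↔ ∀ a, ¬ (.pos a ∈ S ∪ logicalLits V D ∧ .neg a ∈ S ∪ logicalLits V D) := Iff.rfl

theorem IsTwoValuedOn.restrictAtoms {A : Set (DomAtom V D)} {S : Struct V D}
    (h : IsTwoValuedOn Set.univ S) : IsTwoValuedOn A (restrictAtoms S A) := by
  refine ⟨h.1.mono (restrictAtoms_subset S A), fun a ha => ?_, fun a ha => ?_⟩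
  · have := h.2.1 a trivial
    simpa only [mem_restrictAtoms, DomLit.atom, ha, and_true] using this
  · exact ⟨fun k => ha k.2, fun k => ha k.2⟩

theorem IsTwoValuedOn.restrictAtoms_self {A : Set (DomAtom V D)} {S : Struct V D}
    (h : IsTwoValuedOn A S) : FOID.restrictAtoms S A = S := by
  refine Set.Subset.antisymm (restrictAtoms_subset S A) ?_
  rintro (a | a) hl
  · exact ⟨hl, by_contra fun ha => (h.2.2 a ha).1 hl⟩
  · exact ⟨hl, by_contra fun ha => (h.2.2 a ha).2 hl⟩

/-- A consistent set of literals extends, on any set of atoms, to a two-valued structure. -/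
theorem exists_isTwoValuedOn_extending (A : Set (DomAtom V D)) {N : Struct V D}
    (hN : Consistent N) : ∃ O, IsTwoValuedOn A O ∧ restrictAtoms N A ⊆ O := by
  classical
  rw [consistent_iff] at hN
  -- The atoms about which neither `N` nor the logical literals say anything are made false.
  let T : Set (DomAtom V D) := {a | .pos a ∈ N ∪ logicalLits V D}
  let O : Struct V D := {l | l.atom ∈ A ∧ ((∃ a ∈ T, l = .pos a) ∨ ∃ a ∉ T, l = .neg a)}
  have hpos : ∀ a, .pos a ∈ O ↔ a ∈ A ∧ a ∈ T := fun a => by simp [O, DomLit.atom]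
  have hneg : ∀ a, .neg a ∈ O ↔ a ∈ A ∧ a ∉ T := fun a => by simp [O, DomLit.atom]
  refine ⟨O, ⟨?_, fun a ha => ?_, fun a ha => ?_⟩, ?_⟩
  · rw [consistent_iff]
    rintro a ⟨h, h'⟩
    have h₁ : a ∈ T := h.elim (fun k => ((hpos a).1 k).2) Or.inr
    exact h'.elim (fun k => ((hneg a).1 k).2 h₁) fun k => hN a ⟨h₁, Or.inr k⟩
  · rw [hpos, hneg]
    by_cases k : a ∈ T <;> simp [Xor, ha, k]
  · rw [hpos, hneg]
    exact ⟨fun k => ha k.1, fun k => ha k.1⟩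
  · rintro (a | a) ⟨hl, ha⟩
    · exact (hpos a).2 ⟨ha, Or.inl hl⟩
    · exact (hneg a).2 ⟨ha, fun k => hN a ⟨k, Or.inl hl⟩⟩

/-! ### Dependence on the vocabulary -/

theorem val_congr {σ : Set V.Pred} {X Y : Struct V D}
    (h : restrictAtoms X (atomsOver D σ) = restrictAtoms Y (atomsOver D σ))
    {a : DomAtom V D} (ha : a ∈ atomsOver D σ) : val X a = val Y a := by
  have key : ∀ l : DomLit V D, l.atom = a → (l ∈ X ↔ l ∈ Y) := by
    rintro l rfl
    have := Set.ext_iff.1 h l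
    simpa only [mem_restrictAtoms, ha, and_true] using this
  unfold val
  simp only [Set.mem_union, key (.pos a) rfl, key (.neg a) rfl]

/-- The value of a formula depends only on the literals over its own symbols. -/
theorem Formula.eval_congr {σ : Set V.Pred} {X Y : Struct V D}
    (h : restrictAtoms X (atomsOver D σ) = restrictAtoms Y (atomsOver D σ)) :
    ∀ {n : ℕ} (φ : Formula V D n) (x : Fin n → D), φ.voc ⊆ σ → φ.eval X x = φ.eval Y x
  | _, .verum, _, _ => val_congr h fun _ _ e => by cases e
  | _, .falsum, _, _ => val_congr h fun _ _ e => by cases e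
  | _, .eq _ _, _, _ => val_congr h fun _ _ e => by cases e
  | _, .pred _ _, _, hσ => val_congr h fun _ _ e => by cases e; exact hσ rfl
  | _, .not φ, x, hσ => congrArg TruthVal.inv (φ.eval_congr h x hσ)
  | _, .and φ ψ, x, hσ => congrArg₂ (· ⊓ ·)
      (φ.eval_congr h x (Set.subset_union_left.trans hσ))
      (ψ.eval_congr h x (Set.subset_union_right.trans hσ))
  | _, .or φ ψ, x, hσ => congrArg₂ (· ⊔ ·)
      (φ.eval_congr h x (Set.subset_union_left.trans hσ))
      (ψ.eval_congr h x (Set.subset_union_right.trans hσ))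
  | _, .ex _ φ, _, hσ => iSup_congr fun _ => iSup_congr fun _ => φ.eval_congr h _ hσ
  | _, .all _ φ, _, hσ => iInf_congr fun _ => iInf_congr fun _ => φ.eval_congr h _ hσ

theorem definedAtoms_subset_atomsOver {Δ : Definition V D} {σ : Set V.Pred} (hσ : voc Δ ⊆ σ) :
    definedAtoms Δ ⊆ atomsOver D σ := by
  rintro _ ⟨r, hr, x, -, rfl⟩ P d e
  cases e
  exact hσ ⟨r, hr, Or.inl rfl⟩

theorem body_voc_subset {Δ : Definition V D} {σ : Set V.Pred} (hσ : voc Δ ⊆ σ) {r : Rule V D}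
    (hr : r ∈ Δ) : r.body.voc ⊆ σ :=
  fun _ hQ => hσ ⟨r, hr, Or.inr hQ⟩

theorem isUnfounded_restrictAtoms {Δ : Definition V D} {σ : Set V.Pred} (hσ : voc Δ ⊆ σ)
    (X : Struct V D) (U : Set (DomAtom V D)) :
    IsUnfounded Δ (restrictAtoms X (atomsOver D σ)) U ↔ IsUnfounded Δ X U := by
  refine and_congr_right fun _ => forall₂_congr fun r hr => forall₃_congr fun x _ _ => ?_
  rw [Formula.eval_congr (σ := σ) (X := restrictAtoms X (atomsOver D σ) ∪ _)
    (Y := X ∪ DomLit.neg '' U) ?_ _ _ (body_voc_subset hσ hr)]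
  ext l
  simp only [mem_restrictAtoms, Set.mem_union]
  tauto

theorem restrictAtoms_wfStep {Δ : Definition V D} {σ : Set V.Pred} (hσ : voc Δ ⊆ σ)
    (O X : Struct V D) :
    restrictAtoms (wfStep Δ O X) (atomsOver D σ) =
      wfStep Δ (restrictAtoms O (atomsOver D σ)) (restrictAtoms X (atomsOver D σ)) := by
  have hX : restrictAtoms (restrictAtoms X (atomsOver D σ)) (atomsOver D σ) =
      restrictAtoms X (atomsOver D σ) := by
    ext l
    simp only [mem_restrictAtoms, and_assoc, and_self]
  have hdef := definedAtoms_subset_atomsOver hσ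
  ext l
  constructor
  · rintro ⟨(⟨hl, hopen⟩ | ⟨r, hr, x, hx, rfl, k⟩) | ⟨U, hU, a, ha, rfl⟩, hlσ⟩
    · exact Or.inl (Or.inl ⟨⟨hl, hlσ⟩, hopen⟩)
    · refine Or.inl (Or.inr ⟨r, hr, x, hx, rfl, ?_⟩)
      rwa [Formula.eval_congr hX _ _ (body_voc_subset hσ hr)]
    · exact Or.inr ⟨U, (isUnfounded_restrictAtoms hσ X U).2 hU, a, ha, rfl⟩
  · rintro ((⟨⟨hl, hlσ⟩, hopen⟩ | ⟨r, hr, x, hx, rfl, k⟩) | ⟨U, hU, a, ha, rfl⟩)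
    · exact ⟨Or.inl (Or.inl ⟨hl, hopen⟩), hlσ⟩
    · refine ⟨Or.inl (Or.inr ⟨r, hr, x, hx, rfl, ?_⟩), hdef ⟨r, hr, x, hx, rfl⟩⟩
      rwa [Formula.eval_congr hX _ _ (body_voc_subset hσ hr)] at k
    · exact ⟨Or.inr ⟨U, (isUnfounded_restrictAtoms hσ X U).1 hU, a, ha, rfl⟩, hdef (hU.1 ha)⟩

theorem wfStep_wfModel (Δ : Definition V D) (O : Struct V D) :
    wfStep Δ O (wfModel Δ O) = wfModel Δ O :=
  OrderHom.map_lfp ⟨wfStep Δ O, wfStep_mono Δ O⟩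

theorem wfModel_subset {Δ : Definition V D} {O X : Struct V D} (h : wfStep Δ O X ⊆ X) :
    wfModel Δ O ⊆ X :=
  OrderHom.lfp_le ⟨wfStep Δ O, wfStep_mono Δ O⟩ h

/-- Taking the well-founded model commutes with the restriction to any set of symbols that contains
those of the definition. -/
theorem restrictAtoms_wfModel {Δ : Definition V D} {σ : Set V.Pred} (hσ : voc Δ ⊆ σ)
    (O : Struct V D) :
    restrictAtoms (wfModel Δ O) (atomsOver D σ) =
      wfModel Δ (restrictAtoms O (atomsOver D σ)) := by
  set W' := wfModel Δ (restrictAtoms O (atomsOver D σ)) with hW'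
  refine Set.Subset.antisymm ?_ (wfModel_subset ?_)
  · -- The largest structure with restriction below `W'` is closed under the unrestricted operator.
    let Y : Struct V D := {l | l.atom ∈ atomsOver D σ → l ∈ W'}
    have hY : restrictAtoms Y (atomsOver D σ) ⊆ W' := fun l hl => hl.1 hl.2
    have hle : wfModel Δ O ⊆ Y := by
      refine wfModel_subset fun l hl hlσ => ?_
      have h₁ : l ∈ wfStep Δ (restrictAtoms O (atomsOver D σ))
          (restrictAtoms Y (atomsOver D σ)) := by
        rw [← restrictAtoms_wfStep hσ]
        exact ⟨hl, hlσ⟩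
      rw [hW', ← wfStep_wfModel]
      exact wfStep_mono _ _ hY h₁
    exact fun l hl => hle hl.1 hl.2
  · rw [← restrictAtoms_wfStep hσ, wfStep_wfModel]

/-- The well-founded operator copies the open literals and derives only defined ones. -/
theorem restrictAtoms_wfModel_openAtoms (Δ : Definition V D) (O : Struct V D) :
    restrictAtoms (wfModel Δ O) (openAtoms Δ) = restrictAtoms O (openAtoms Δ) := by
  refine Set.Subset.antisymm ?_ fun l hl => ⟨?_, hl.2⟩
  · rintro l ⟨hl, hopen⟩
    rw [← wfStep_wfModel] at hl
    rcases hl with (hl | ⟨r, hr, x, hx, rfl, -⟩) | ⟨U, hU, a, ha, rfl⟩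
    · exact hl
    · exact absurd ⟨r, hr, x, hx, rfl⟩ hopen
    · exact absurd (hU.1 ha) hopen
  · rw [← wfStep_wfModel]
    exact Or.inl (Or.inl hl)

theorem IsModelOver.restrictAtoms {Δ : Definition V D} {σ : Set V.Pred} (hσ : voc Δ ⊆ σ)
    {M : Struct V D} (hM : IsTwoValuedOn Set.univ M)
    (hwf : M = wfModel Δ (restrictAtoms M (openAtoms Δ))) :
    IsModelOver σ (restrictAtoms M (atomsOver D σ)) Δ := by
  refine ⟨hM.restrictAtoms, ?_⟩
  rw [restrictAtoms_comm, ← restrictAtoms_wfModel hσ, ← hwf]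

/-- A model of `Δ` over its own symbols extends to the whole vocabulary, with the values of the
other symbols prescribed by any two-valued structure. -/
theorem IsModelOver.extend {Δ : Definition V D} {M₀ M₁ : Struct V D}
    (hM₀ : IsTwoValuedOn Set.univ M₀) (hM₁ : IsModelOver (voc Δ) M₁ Δ) :
    IsModelOver Set.univ (M₁ ∪ FOID.restrictAtoms M₀ (atomsOver D (voc Δ))ᶜ) Δ := by
  set A : Set (DomAtom V D) := atomsOver D (voc Δ) with hA
  set M : Struct V D := M₁ ∪ FOID.restrictAtoms M₀ Aᶜ with hM
  have hin : ∀ l : DomLit V D, l.atom ∈ A → (l ∈ M ↔ l ∈ M₁) := fun l hl =>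
    ⟨fun h => h.elim id fun k => absurd hl k.2, Or.inl⟩
  have hout : ∀ l : DomLit V D, l.atom ∉ A → (l ∈ M ↔ l ∈ M₀) := fun l hl =>
    ⟨fun h => h.elim (fun k => by
      rw [← hM₁.1.restrictAtoms_self] at k
      exact absurd k.2 hl) fun k => k.1, fun h => Or.inr ⟨h, hl⟩⟩
  have hres : FOID.restrictAtoms M A = M₁ := by
    rw [← hM₁.1.restrictAtoms_self]
    ext l
    exact and_congr_left fun hl => hin l hl
  refine ⟨⟨?_, fun a _ => ?_, fun a ha => ?_⟩, ?_⟩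
  · rw [consistent_iff]
    rintro a ⟨h, h'⟩
    by_cases ha : a ∈ A
    · exact hM₁.1.1 a ⟨h.imp_left (hin (.pos a) ha).1, h'.imp_left (hin (.neg a) ha).1⟩
    · exact hM₀.1 a ⟨h.imp_left (hout (.pos a) ha).1, h'.imp_left (hout (.neg a) ha).1⟩
  · by_cases ha : a ∈ A
    · rw [hin (.pos a) ha, hin (.neg a) ha]
      exact hM₁.1.2.1 a ha
    · rw [hout (.pos a) ha, hout (.neg a) ha]
      exact hM₀.2.1 a trivial
  · exact absurd (fun _ _ _ => trivial) ha
  · have hwf : FOID.restrictAtoms (wfModel Δ (FOID.restrictAtoms M (openAtoms Δ))) A =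
        FOID.restrictAtoms M A := by
      rw [restrictAtoms_wfModel subset_rfl, restrictAtoms_comm, ← hA, hres]
      exact hM₁.2.symm
    have hopen := restrictAtoms_wfModel_openAtoms Δ (FOID.restrictAtoms M (openAtoms Δ))
    ext l
    by_cases hl : l.atom ∈ A
    · have := Set.ext_iff.1 hwf l
      simp only [mem_restrictAtoms, hl, and_true] at this
      exact this.symm
    · -- Atoms over symbols that do not occur in `Δ` are open.
      have hlo : l.atom ∈ openAtoms Δ := fun h => hl (definedAtoms_subset_atomsOver subset_rfl h)
      have := Set.ext_iff.1 hopen l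
      simp only [mem_restrictAtoms, hlo, and_true] at this
      exact this.symm

/-! ### Justified literals and well-founded models -/

theorem RulesDisjoint.union {Δ Δ' : Definition V D} (h : RulesDisjoint Δ) (h' : RulesDisjoint Δ')
    (hd : Disjoint (definedAtoms Δ) (definedAtoms Δ')) : RulesDisjoint (Δ ∪ Δ') := by
  rw [Set.disjoint_left] at hd
  rintro r (hr | hr) r' (hr' | hr') x hx x' hx' e
  · exact h r hr r' hr' x hx x' hx' e
  · exact absurd ⟨r', hr', x', hx', e⟩ (hd ⟨r, hr, x, hx, rfl⟩)
  · exact absurd ⟨r, hr, x, hx, rfl⟩ (hd ⟨r', hr', x', hx', e⟩)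
  · exact h' r hr r' hr' x hx x' hx' e

/-- The well-founded operator derives every literal that has a direct justification.  For a negative
literal `¬ a` the unfounded set is `{a}`; it is the uniqueness of the rule for `a` that makes it
unfounded. -/
theorem IsDirectJustification.mem_wfStep {Δ : Definition V D} (hΔ : RulesDisjoint Δ)
    {l : DomLit V D} {S : Set (DomLit V D)} (h : IsDirectJustification Δ l S) {O X : Struct V D}
    (hS : S ⊆ X) : l ∈ wfStep Δ O X := by
  obtain ⟨-, -, r, hr, x, hx, ⟨rfl, k⟩ | ⟨rfl, k⟩⟩ := h
  · refine Or.inl (Or.inr ⟨r, hr, x, hx, rfl, (Formula.eval_mono hS _ _).1 ?_⟩)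
    rw [k]
    exact trivial
  · refine Or.inr ⟨{.pred r.P x}, ⟨?_, fun r' hr' x' hx' e => ?_⟩, _, rfl, rfl⟩
    · rintro _ rfl
      exact ⟨r, hr, x, hx, rfl⟩
    · obtain rfl := hΔ r' hr' r hr x' hx' x hx e
      cases e
      refine (Formula.eval_mono (hS.trans Set.subset_union_left) _ _).2 ?_
      rw [k]
      exact trivial

/-- A justified positive literal starts no infinite path. -/
theorem WellFoundedIn.acc {J : LitGraph V D} {a : DomAtom V D} (h : WellFoundedIn J (.pos a)) :
    Acc (fun k' k => k' ∈ J k) (.pos a) := by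
  rw [acc_iff_isEmpty_descending_chain]
  refine ⟨fun ⟨f, hf₀, hf⟩ => ?_⟩
  have hmem : ∀ i, f i ∈ nodesFrom J {.pos a} := by
    intro i
    refine ⟨_, rfl, ?_⟩
    induction i with
    | zero => rw [hf₀]
    | succ i ih => exact ih.tail (hf i)
  have := h f (fun i => ⟨hmem i, hf i⟩) 0
  rwa [hf₀] at this

theorem nodesFrom_closed {J : LitGraph V D} {L : Set (DomLit V D)} {k l : DomLit V D}
    (hk : k ∈ nodesFrom J L) (hl : l ∈ J k) : l ∈ nodesFrom J L := by
  obtain ⟨l₀, hl₀, h⟩ := hk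
  exact ⟨l₀, hl₀, h.tail hl⟩

/-- Restricting a graph to what is reachable from `L` does not change what is reachable. -/
theorem nodesFrom_subgraphFrom (J : LitGraph V D) (L : Set (DomLit V D)) :
    nodesFrom (subgraphFrom J L) L = nodesFrom J L := by
  refine Set.Subset.antisymm ?_ ?_
  · rintro l ⟨l₀, hl₀, h⟩
    exact ⟨l₀, hl₀, Relation.ReflTransGen.mono (fun _ _ k => k.2) _ _ h⟩
  · rintro l ⟨l₀, hl₀, h⟩
    induction h with
    | refl => exact ⟨l₀, hl₀, .refl⟩
    | tail hb hbc ih => exact nodesFrom_closed ih ⟨⟨l₀, hl₀, hb⟩, hbc⟩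

/-- If `J` justifies a positive literal, then all literals of its justification belong to every
fixpoint of the well-founded operator that contains the open ones among them. -/
theorem nodesFrom_subset_of_isFixedPt {Δ : Definition V D} (hΔ : RulesDisjoint Δ)
    {J : LitGraph V D} {p : DomAtom V D} (hJ : Justifies Δ J {.pos p}) {O W : Struct V D}
    (hW : wfStep Δ O W = W)
    (hopen : restrictAtoms (nodesFrom J {.pos p}) (openAtoms Δ) ⊆ W) :
    nodesFrom J {.pos p} ⊆ W := by
  have main : ∀ l, Acc (fun k' k => k' ∈ J k) l → l ∈ nodesFrom J {.pos p} → l ∈ W := by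
    intro l hacc
    induction hacc with
    | intro l _ ih =>
      intro hl
      by_cases hd : IsDefined Δ l
      · have hne : (J l).Nonempty :=
          (hJ.total l (by rwa [nodesFrom_subgraphFrom]) hd).mono fun _ k => k.2
        have hdir := (hJ.justification l).resolve_left hne.ne_empty
        rw [← hW]
        exact hdir.mem_wfStep hΔ fun k hk => ih k hk (nodesFrom_closed hl hk)
      · exact hopen ⟨hl, hd⟩
  rintro l ⟨l₀, rfl, h⟩
  refine main l ?_ ⟨_, rfl, h⟩
  have hacc := (hJ.wellFounded _ rfl).acc
  induction h with
  | refl => exact hacc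
  | tail _ hbc ih => exact ih.inv hbc

end FOID

open FOID in
theorem mainTheorem2 {V : FOID.Vocabulary} {D : Type*}
    (p : FOID.DomAtom V D) (Δ Δg Δd : FOID.Definition V D)
    (Iin I : FOID.Struct V D) (J : FOID.LitGraph V D)
    (hΔ : FOID.RulesDisjoint Δ) (hΔg : FOID.RulesDisjoint Δg) (hΔd : FOID.RulesDisjoint Δd)
    (htotal : FOID.Total Δ)
    (hstate : FOID.IsAcceptable Δ Iin Δg Δd J I)
    (hp : FOID.TrueIn I (.pos p))
    (hJ : FOID.Justifies (Δg ∪ Δd) J {.pos p}) :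
    ∃ M : FOID.Struct V D, FOID.IsModelOfTheory M p Δ ∧
      I ∩ {l ∈ FOID.nodesFrom J {.pos p} | FOID.IsDefined (Δg ∪ Δd) l} ⊆ M := by
  have hdisj := hΔg.union hΔd hstate.disjoint
  obtain ⟨O, hO, hNO⟩ := exists_isTwoValuedOn_extending (openAtoms (Δg ∪ Δd)) hJ.consistent
  set M₀ := wfModel (Δg ∪ Δd) O with hM₀
  have hM₀O : restrictAtoms M₀ (openAtoms (Δg ∪ Δd)) = O := by
    rw [hM₀, restrictAtoms_wfModel_openAtoms, hO.restrictAtoms_self]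
  have hM₀two : IsTwoValuedOn Set.univ M₀ := hstate.total_union O hO
  have hN : nodesFrom J {.pos p} ⊆ M₀ :=
    nodesFrom_subset_of_isFixedPt hdisj hJ (wfStep_wfModel _ O)
      (hNO.trans (hM₀O.symm.subset.trans (restrictAtoms_subset _ _)))
  have hmodel : IsModelOver (voc (Δg ∪ Δd))
      (restrictAtoms M₀ (atomsOver D (voc (Δg ∪ Δd)))) (Δg ∪ Δd) :=
    IsModelOver.restrictAtoms subset_rfl hM₀two (by rw [hM₀O])
  obtain ⟨M₁, ⟨hM₁, hsub⟩, -⟩ := hstate.equivalent.1 _ hmodel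
  have hM := IsModelOver.extend hM₀two hM₁
  -- A defined literal lies over the symbols of `Δg ∪ Δd`; it keeps its value through the passage to
  -- the symbols of `Δ`, or else its symbol does not occur in `Δ`.
  have hS : ∀ l ∈ nodesFrom J {.pos p}, IsDefined (Δg ∪ Δd) l →
      l ∈ M₁ ∪ restrictAtoms M₀ (atomsOver D (voc Δ))ᶜ := by
    intro l hl hd
    by_cases hlσ : l.atom ∈ atomsOver D (voc Δ)
    · exact Or.inl (hsub ⟨⟨hN hl, definedAtoms_subset_atomsOver subset_rfl hd⟩, hlσ⟩)
    · exact Or.inr ⟨hN hl, hlσ⟩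
  have hpM := hS _ ⟨_, rfl, .refl⟩ (hJ.isDefined _ rfl)
  refine ⟨_, ⟨hM, ?_⟩, fun l hl => hS l hl.2.1 hl.2.2⟩
  have hcon := fun k => hM.1.1 p ⟨Or.inl hpM, k⟩
  exact Prod.ext (eq_true (Or.inl hpM)) (eq_false hcon)
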